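/- **Lemma (tidal curvature of a Rosen metric).** Let $\mathbb U\subset\mathbb R$ be a nondegenerate interval, $\mathbb X$ a finite-dimensional real Euclidean space, and let $h(u)$, $u\in\mathbb U$, be a positive-definite symmetric endomorphism of $\mathbb X$ depending smoothly on $u$. Consider the Rosen metric $$G_\rho(h)=2\,du\,dv-dx^T h(u)\,dx$$ on $\mathbb M=\mathbb U\times\mathbb R\times\mathbb X$, with Levi-Civita connection $\nabla$ and curvature $R(X,Y)Z=\nabla_X\nabla_YZ-\nabla_Y\nabla_XZ-\nabla_{[X,Y]}Z$. Let $H:\mathbb U\to\operatorname{End}(\mathbb X)$ be any function with $\dot H=h^{-1}$, where dots (or primes) denote derivatives in $u$. Then: 1. The central curve $\gamma(u)=(u,0,0)$ is an affinely parametrized null geodesic of $G_\rho(h)$. 2. At each $u\in\mathbb U$, the form $(\xi,\eta)\mapsto G_\rho(h)\bigl(R(\xi,\dot\gamma)\dot\gamma,\eta\bigr)$ on $\dot\gamma^\perp$ descends to a unique bilinear form $P$ on the normal space $\dot\gamma^\perp/\langle\dot\gamma\rangle$, the normal tidal curvature of $\gamma$, and $$P=-\tfrac12\,dx^T\,\dot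 H^{-1}\Bigl(\dddot H-\tfrac32\,\ddot H\dot H^{-1}\ddot H\Bigr)\dot H^{-1}\,dx .$$ 3. Consequently the normal tidal curvature is given by the Lagrange–Schwarzian: let $L:\mathbb U\to\operatorname{End}(\mathbb X)$ be any Lagrangian matrix (that is, $L$ is smooth, $L^T\dot L$ is symmetric, and $L\oplus\dot L:\mathbb X\to\mathbb X\oplus\mathbb X$ has full rank) with $L^TL=h$, and let $\mathcal S=L\bigl(\dddot H-\tfrac32\,\ddot H\dot H^{-1}\ddot H\bigr)L^T$ be the Lagrange–Schwarzian of $H$ relative to $L$. Then $$P=-\tfrac12\,(L\,dx)^T\,\mathcal S\,(L\,dx).$$ -/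

import Mathlib

open scoped ContDiff InnerProductSpace

noncomputable section

/-! Pseudo-Riemannian geometry on a subset `M` of a normed space `E` (a single global chart).
A metric is a field `g` of bilinear forms; every derivative is taken within `M`. -/

section Geometry

variable {E : Type*} [NormedAddCommGroup E] [NormedSpace ℝ E]

/-- The Christoffel symbols of the first kind, as the covector
`Z ↦ ½ (∂_X g(Y, Z) + ∂_Y g(X, Z) - ∂_Z g(X, Y))`. -/
def christoffelFirst (g : E → E →L[ℝ] E →L[ℝ] ℝ) (M : Set E) (p X Y : E) : E →L[ℝ] ℝ :=
  (1 / 2 : ℝ) • (fderivWithin ℝ g M p X Y + fderivWithin ℝ g M p Y X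
    - ((fderivWithin ℝ g M p).flip X).flip Y)

/-- The Christoffel symbols `Γ_p(X, Y)` of the Levi-Civita connection: the index of
`christoffelFirst` is raised by the inverse of `g p`, regarded as a map from vectors to covectors. -/
def christoffel (g : E → E →L[ℝ] E →L[ℝ] ℝ) (M : Set E) (p X Y : E) : E :=
  (g p).inverse (christoffelFirst g M p X Y)

/-- The Riemann curvature `R(X, Y) Z = ∇_X ∇_Y Z - ∇_Y ∇_X Z - ∇_[X, Y] Z` at `p`, evaluated on
the constant extensions of the vectors `X`, `Y`, `Z`, whose brackets vanish. -/
def riemann (g : E → E →L[ℝ] E →L[ℝ] ℝ) (M : Set E) (p X Y Z : E) : E :=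
  fderivWithin ℝ (fun q => christoffel g M q Y Z) M p X
    - fderivWithin ℝ (fun q => christoffel g M q X Z) M p Y
    + christoffel g M p X (christoffel g M p Y Z)
    - christoffel g M p Y (christoffel g M p X Z)

/-- The curve `c : U → M` is an affinely parametrized null geodesic of `g`. -/
structure IsNullGeodesic (g : E → E →L[ℝ] E →L[ℝ] ℝ) (M : Set E) (U : Set ℝ) (c : ℝ → E) :
    Prop where
  mapsTo : Set.MapsTo c U M
  smooth : ContDiffOn ℝ ∞ c U
  tangent_ne_zero : ∀ u ∈ U, derivWithin c U u ≠ 0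
  null : ∀ u ∈ U, g (c u) (derivWithin c U u) (derivWithin c U u) = 0
  geodesic : ∀ u ∈ U, iteratedDerivWithin 2 c U u
    + christoffel g M (c u) (derivWithin c U u) (derivWithin c U u) = 0

/-- The vectors orthogonal to `T`. -/
abbrev orthVectors (b : E →L[ℝ] E →L[ℝ] ℝ) (T : E) : Submodule ℝ E :=
  LinearMap.ker (b T : E →ₗ[ℝ] ℝ)

/-- The normal space `T^⊥ / T` of a null direction `T`. -/
abbrev ScreenSpace (b : E →L[ℝ] E →L[ℝ] ℝ) (T : E) : Type _ :=
  orthVectors b T ⧸ (Submodule.span ℝ {T}).submoduleOf (orthVectors b T)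

/-- The class in `T^⊥ / T` of a vector of `T^⊥`. -/
abbrev screenClass (b : E →L[ℝ] E →L[ℝ] ℝ) (T : E) (ξ : orthVectors b T) : ScreenSpace b T :=
  Submodule.Quotient.mk ξ

/-- `P` is the normal tidal curvature at `p` of a null geodesic with tangent vector `T` there: the
bilinear form on `T^⊥ / T` induced by `(ξ, η) ↦ g(R(ξ, T) T, η)`. -/
def IsNormalTidalCurvature (g : E → E →L[ℝ] E →L[ℝ] ℝ) (M : Set E) (p T : E)
    (P : LinearMap.BilinForm ℝ (ScreenSpace (g p) T)) : Prop :=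
  ∀ ξ η : orthVectors (g p) T,
    P (screenClass (g p) T ξ) (screenClass (g p) T η) = g p (riemann g M p ξ T T) η

end Geometry

section Rosen

variable {X : Type*} [NormedAddCommGroup X] [InnerProductSpace ℝ X]

/-- The spacetime `U × ℝ × X`, with coordinates `(u, v, x)`, as a subset of `ℝ × ℝ × X`. -/
def spacetime (X : Type*) (U : Set ℝ) : Set (ℝ × ℝ × X) := {p | p.1 ∈ U}

/-- `h` is a positive-definite symmetric endomorphism of `X` depending smoothly on `u ∈ U`. -/
structure IsRosenProfile (U : Set ℝ) (h : ℝ → X →L[ℝ] X) : Prop where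
  smooth : ContDiffOn ℝ ∞ h U
  symmetric : ∀ u ∈ U, ∀ x y : X, ⟪h u x, y⟫_ℝ = ⟪x, h u y⟫_ℝ
  posDef : ∀ u ∈ U, ∀ x : X, x ≠ 0 → 0 < ⟪x, h u x⟫_ℝ

/-- The coordinate differential `du`. -/
def formU (X : Type*) [NormedAddCommGroup X] [InnerProductSpace ℝ X] : (ℝ × ℝ × X) →L[ℝ] ℝ :=
  ContinuousLinearMap.fst ℝ ℝ (ℝ × X)

/-- The coordinate differential `dv`. -/
def formV (X : Type*) [NormedAddCommGroup X] [InnerProductSpace ℝ X] : (ℝ × ℝ × X) →L[ℝ] ℝ :=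
  (ContinuousLinearMap.fst ℝ ℝ X).comp (ContinuousLinearMap.snd ℝ ℝ (ℝ × X))

/-- The vector-valued coordinate differential `dx`. -/
def formX (X : Type*) [NormedAddCommGroup X] [InnerProductSpace ℝ X] : (ℝ × ℝ × X) →L[ℝ] X :=
  (ContinuousLinearMap.snd ℝ ℝ X).comp (ContinuousLinearMap.snd ℝ ℝ (ℝ × X))

/-- The Euclidean inner product of `X` as a continuous bilinear form. -/
def euclInner (X : Type*) [NormedAddCommGroup X] [InnerProductSpace ℝ X] : X →L[ℝ] X →L[ℝ] ℝ :=
  innerSL ℝ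

/-- The Rosen metric `2 du dv - dxᵀ h(u) dx`. -/
def rosenMetric (h : ℝ → X →L[ℝ] X) (p : ℝ × ℝ × X) :
    (ℝ × ℝ × X) →L[ℝ] (ℝ × ℝ × X) →L[ℝ] ℝ :=
  (formU X).smulRight (formV X) + (formV X).smulRight (formU X)
    - (euclInner X).bilinearComp (formX X) ((h p.1).comp (formX X))

theorem rosenMetric_apply (h : ℝ → X →L[ℝ] X) (p ξ η : ℝ × ℝ × X) :
    rosenMetric h p ξ η = ξ.1 * η.2.1 + ξ.2.1 * η.1 - ⟪ξ.2.2, h p.1 η.2.2⟫_ℝ := by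
  simp [rosenMetric, formU, formV, formX, euclInner]
  rfl

/-- The central null geodesic `u ↦ (u, 0, 0)`. -/
def centralCurve (X : Type*) [NormedAddCommGroup X] [InnerProductSpace ℝ X] (u : ℝ) : ℝ × ℝ × X :=
  (u, 0, 0)

/-- The tangent vector `∂_u` of the central null geodesic. -/
def centralTangent (X : Type*) [NormedAddCommGroup X] [InnerProductSpace ℝ X] (U : Set ℝ) (u : ℝ) :
    ℝ × ℝ × X :=
  derivWithin (centralCurve X) U u

/-- The operator `H''' - (3/2) H'' (H')⁻¹ H''`. -/
def schwarzOperator (U : Set ℝ) (H : ℝ → X →L[ℝ] X) (u : ℝ) : X →L[ℝ] X :=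
  iteratedDerivWithin 3 H U u - (3 / 2 : ℝ) •
    ((iteratedDerivWithin 2 H U u).comp
      ((derivWithin H U u).inverse.comp (iteratedDerivWithin 2 H U u)))

variable [FiniteDimensional ℝ X]

/-- The transpose of an endomorphism of the Euclidean space `X`. -/
def euclTranspose (A : X →L[ℝ] X) : X →L[ℝ] X :=
  LinearMap.toContinuousLinearMap (LinearMap.adjoint (A : X →ₗ[ℝ] X))

/-- Lagrangian matrices: `L` is smooth, `Lᵀ L'` is symmetric, and `L ⊕ L' : X → X ⊕ X` has full
rank. -/
structure IsLagrangianMatrix (U : Set ℝ) (L : ℝ → X →L[ℝ] X) : Prop where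
  smooth : ContDiffOn ℝ ∞ L U
  symmetric : ∀ u ∈ U, (euclTranspose (L u)).comp (derivWithin L U u)
    = (euclTranspose (derivWithin L U u)).comp (L u)
  fullRank : ∀ u ∈ U, ∀ x : X, L u x = 0 → derivWithin L U u x = 0 → x = 0

/-- The Lagrange--Schwarzian `L (H''' - (3/2) H'' (H')⁻¹ H'') Lᵀ` of `H` relative to `L`. -/
def lagrangeSchwarzian (U : Set ℝ) (H L : ℝ → X →L[ℝ] X) (u : ℝ) : X →L[ℝ] X :=
  (L u).comp ((schwarzOperator U H u).comp (euclTranspose (L u)))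

end Rosen

end

/-! ### Inverses of linear maps and their derivatives -/

section Invertibility

variable {E F : Type*} [NormedAddCommGroup E] [NormedSpace ℝ E] [NormedAddCommGroup F]
  [NormedSpace ℝ F] [FiniteDimensional ℝ E] [FiniteDimensional ℝ F]

/-! The metric depends on the point only through `h(u)`, so the Koszul formula leaves few
Christoffel terms (`IsRosenProfile.christoffel_eq`). With T = ∂_u, Γ(T, T) = 0, so the central curve
is a geodesic, and Γ(ξ, T) has only the X-component ½ h⁻¹h'ξ_x. Hence R(ξ, T)T = -½(h⁻¹h')'ξ_x -
¼(h⁻¹h')²ξ_x = -½ h⁻¹(h'' - ½ h'h⁻¹h')ξ_x (`IsRosenProfile.riemann_eq`).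

Differentiating H' = h⁻¹ twice turns the bracket into the Schwarz operator S of H: h S h = -(h'' - ½
h'h⁻¹h') (`schwarzOperator_eq`). Lowering the index gives the tidal form -½⟨ξ_x, h S h η_x⟩. It sees
only dx, which kills T, so it descends to T^⊥/T. Writing h = LᵀL regroups h S h as Lᵀ(L S Lᵀ)L, the
Lagrange–Schwarzian form. -/

theorem isInvertible_of_injective (f : E →L[ℝ] F) (hf : Function.Injective f)
    (hd : Module.finrank ℝ E = Module.finrank ℝ F) : f.IsInvertible :=
  ⟨(LinearMap.linearEquivOfInjective (f : E →ₗ[ℝ] F) hf hd).toContinuousLinearEquiv, by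
    ext x; simp⟩

theorem finrank_continuousDual :
    Module.finrank ℝ (E →L[ℝ] ℝ) = Module.finrank ℝ E := by
  rw [← (LinearMap.toContinuousLinearMap (𝕜 := ℝ) (E := E) (F' := ℝ)).finrank_eq]
  exact Subspace.dual_finrank_eq

end Invertibility

/-- An invertible endomorphism is a unit of the Banach algebra of endomorphisms, so this is the
chain rule for ring inversion. -/
theorem HasDerivWithinAt.clm_inverse {X : Type*} [NormedAddCommGroup X] [NormedSpace ℝ X]
    [CompleteSpace X] {f : ℝ → X →L[ℝ] X} {f' : X →L[ℝ] X} {U : Set ℝ} {u : ℝ}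
    (hf : HasDerivWithinAt f f' U u) (hi : (f u).IsInvertible) :
    HasDerivWithinAt (fun t => (f t).inverse) (-((f u).inverse * f' * (f u).inverse)) U u := by
  obtain ⟨e, he⟩ := hi
  let x : (X →L[ℝ] X)ˣ := (ContinuousLinearEquiv.unitsEquiv ℝ X).symm e
  have hx : (x : X →L[ℝ] X) = f u := he
  have hxi : ((x⁻¹ : (X →L[ℝ] X)ˣ) : X →L[ℝ] X) = (f u).inverse := by
    rw [← he, ContinuousLinearMap.inverse_equiv]; rfl
  have h1 := hasFDerivAt_ringInverse (𝕜 := ℝ) x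
  rw [hx] at h1
  have h2 := h1.comp_hasDerivWithinAt u hf
  rw [ContinuousLinearMap.ringInverse_eq_inverse] at h2
  refine h2.congr_deriv ?_
  rw [hxi]
  rfl

/-! ### Nondegeneracy, connection and curvature of the Rosen metric -/

section RosenCurvature

variable {X : Type*} [NormedAddCommGroup X] [InnerProductSpace ℝ X]

theorem IsRosenProfile.isInvertible [FiniteDimensional ℝ X] {U : Set ℝ} {h : ℝ → X →L[ℝ] X}
    (hh : IsRosenProfile U h) {u : ℝ} (hu : u ∈ U) : (h u).IsInvertible := by
  refine isInvertible_of_injective _ ((injective_iff_map_eq_zero _).2 fun x hx => ?_) rfl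
  by_contra hne
  simpa [hx] using hh.posDef u hu x hne

/-- Pairing W with ∂_v and ∂_u reads off its u and v components. The metric itself is indefinite,
but pairing W with its own X-part gives minus the definite form of h. -/
theorem rosenMetric_eq_zero_of_forall {h : ℝ → X →L[ℝ] X} {p W : ℝ × ℝ × X}
    (hpos : ∀ x : X, x ≠ 0 → 0 < ⟪x, h p.1 x⟫_ℝ)
    (hW : ∀ Z, rosenMetric h p W Z = 0) : W = 0 := by
  simp only [rosenMetric_apply] at hW
  obtain ⟨a, b, x⟩ := W
  have h1 := hW (0, 1, 0)
  have h2 := hW (1, 0, 0)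
  have h3 := hW (0, 0, x)
  simp only [map_zero, inner_zero_right, mul_zero, mul_one, add_zero, zero_add, sub_zero] at h1 h2
  simp only [mul_zero, add_zero, zero_sub, neg_eq_zero] at h3
  have hx : x = 0 := by
    by_contra hne
    exact (hpos x hne).ne' h3
  simp [h1, h2, hx]

theorem IsRosenProfile.rosenMetric_isInvertible [FiniteDimensional ℝ X] {U : Set ℝ}
    {h : ℝ → X →L[ℝ] X} (hh : IsRosenProfile U h) {p : ℝ × ℝ × X} (hp : p ∈ spacetime X U) :
    (rosenMetric h p).IsInvertible := by
  refine isInvertible_of_injective _ ((injective_iff_map_eq_zero _).2 fun W hW => ?_)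
    finrank_continuousDual.symm
  exact rosenMetric_eq_zero_of_forall (hh.posDef p.1 hp) fun Z => by rw [hW]; rfl

theorem uniqueDiffOn_spacetime {U : Set ℝ} (hU : UniqueDiffOn ℝ U) :
    UniqueDiffOn ℝ (spacetime X U) := by
  have h1 := hU.prod (uniqueDiffOn_univ (𝕜 := ℝ) (E := ℝ × X))
  convert h1 using 1
  ext p; simp [spacetime]

theorem HasDerivWithinAt.comp_fst_spacetime {G : Type*} [NormedAddCommGroup G] [NormedSpace ℝ G]
    {f : ℝ → G} {f' : G} {U : Set ℝ} {p : ℝ × ℝ × X} (hf : HasDerivWithinAt f f' U p.1) :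
    HasFDerivWithinAt (fun q : ℝ × ℝ × X => f q.1) ((formU X).smulRight f')
      (spacetime X U) p := by
  have h1 := hf.hasFDerivWithinAt.comp p
    ((formU X).hasFDerivWithinAt (s := spacetime X U) (x := p)) (fun q hq => hq)
  refine h1.congr_fderiv ?_
  ext <;> simp [formU]

set_option maxSynthPendingDepth 6 in
theorem fderivWithin_rosenMetric [FiniteDimensional ℝ X] {h : ℝ → X →L[ℝ] X} {h' : X →L[ℝ] X}
    {U : Set ℝ} (hU : UniqueDiffOn ℝ U) {p : ℝ × ℝ × X} (hp : p ∈ spacetime X U)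
    (hd : HasDerivWithinAt h h' U p.1) (A B C : ℝ × ℝ × X) :
    fderivWithin ℝ (rosenMetric h) (spacetime X U) p A B C
      = -(A.1 * ⟪B.2.2, h' C.2.2⟫_ℝ) := by
  -- The metric is a constant minus Φ(h(u)) with Φ linear, so its derivative is -Φ(h') du.
  let Φ : (X →L[ℝ] X) →L[ℝ] ((ℝ × ℝ × X) →L[ℝ] (ℝ × ℝ × X) →L[ℝ] ℝ) :=
    LinearMap.toContinuousLinearMap
      { toFun := fun K => (euclInner X).bilinearComp (formX X) (K.comp (formX X))
        map_add' := fun K K' => by ext <;> simp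
        map_smul' := fun c K => by ext <;> simp }
  have hΦ : ∀ K B C, Φ K B C = ⟪B.2.2, K C.2.2⟫_ℝ := fun K B C => rfl
  have h1 := (Φ.hasFDerivAt.comp_hasFDerivWithinAt p hd.comp_fst_spacetime).const_sub
    ((formU X).smulRight (formV X) + (formV X).smulRight (formU X))
  rw [HasFDerivWithinAt.fderivWithin (f := rosenMetric h) h1 (uniqueDiffOn_spacetime hU p hp)]
  simp [hΦ, formU]

theorem IsRosenProfile.christoffel_eq [FiniteDimensional ℝ X] {h : ℝ → X →L[ℝ] X}
    {h' : X →L[ℝ] X} {U : Set ℝ} (hh : IsRosenProfile U h) (hU : UniqueDiffOn ℝ U)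
    {p : ℝ × ℝ × X} (hp : p ∈ spacetime X U) (hd : HasDerivWithinAt h h' U p.1)
    (hs : ∀ x y : X, ⟪h' x, y⟫_ℝ = ⟪x, h' y⟫_ℝ) (A B : ℝ × ℝ × X) :
    christoffel (rosenMetric h) (spacetime X U) p A B
      = (0, (1 / 2 : ℝ) * ⟪A.2.2, h' B.2.2⟫_ℝ,
          (1 / 2 : ℝ) • ((h p.1).inverse * h') (A.1 • B.2.2 + B.1 • A.2.2)) := by
  -- Lower the index: the claimed vector need only pair with every Z as the Koszul covector does.
  rw [christoffel, (hh.rosenMetric_isInvertible hp).inverse_apply_eq]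
  refine ContinuousLinearMap.ext fun Z => ?_
  have hi := hh.isInvertible (u := p.1) hp
  have key : ∀ x y : X, ⟪(h p.1).inverse (h' x), h p.1 y⟫_ℝ = ⟪x, h' y⟫_ℝ := fun x y => by
    rw [← hh.symmetric p.1 hp, hi.self_apply_inverse, hs]
  simp only [christoffelFirst, smul_apply, sub_apply,
    add_apply, ContinuousLinearMap.flip_apply,
    fderivWithin_rosenMetric hU hp hd, rosenMetric_apply, mul_apply_eq_comp, map_add,
    map_smul, inner_smul_left, inner_add_left, key, smul_eq_mul]
  simp
  ring

/-- For `T = ∂_u`, the vector `R(ξ, T) T` only has a component along `X`. -/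
theorem IsRosenProfile.riemann_eq [FiniteDimensional ℝ X] {h h' : ℝ → X →L[ℝ] X}
    {h'' : X →L[ℝ] X} {U : Set ℝ} (hh : IsRosenProfile U h) (hU : UniqueDiffOn ℝ U)
    (hd : ∀ u ∈ U, HasDerivWithinAt h (h' u) U u)
    (hs : ∀ u ∈ U, ∀ x y : X, ⟪h' u x, y⟫_ℝ = ⟪x, h' u y⟫_ℝ)
    {p : ℝ × ℝ × X} (hp : p ∈ spacetime X U) (hdd : HasDerivWithinAt h' h'' U p.1)
    (ξ : ℝ × ℝ × X) :
    riemann (rosenMetric h) (spacetime X U) p ξ (1, 0, 0) (1, 0, 0)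
      = (0, 0, (h p.1).inverse (-(1 / 2 : ℝ) • (h'' ξ.2.2
          - (1 / 2 : ℝ) • h' p.1 ((h p.1).inverse (h' p.1 ξ.2.2))))) := by
  have hΓ : ∀ q ∈ spacetime X U, ∀ A B, christoffel (rosenMetric h) (spacetime X U) q A B = _ :=
    fun q hq A B => hh.christoffel_eq hU hq (hd q.1 hq) (hs q.1 hq) A B
  have hu := uniqueDiffOn_spacetime (X := X) hU p hp
  have h0 : fderivWithin ℝ (fun q => christoffel (rosenMetric h) (spacetime X U) q
      (1, 0, 0) (1, 0, 0)) (spacetime X U) p = 0 := by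
    rw [fderivWithin_congr (f := fun _ => (0 : ℝ × ℝ × X)) (fun q hq => by simp [hΓ q hq])
      (by simp [hΓ p hp])]
    simp
  have h1 : HasDerivWithinAt (fun t => ((0 : ℝ), (0 : ℝ),
      (1 / 2 : ℝ) • ((h t).inverse * h' t) ξ.2.2)) _ U p.1 :=
    (hasDerivWithinAt_const _ _ _).prodMk ((hasDerivWithinAt_const _ _ _).prodMk
      (((((hd p.1 hp).clm_inverse (hh.isInvertible hp)).mul hdd).clm_apply
        (hasDerivWithinAt_const _ _ _)).const_smul (1 / 2 : ℝ)))
  have h2 := (fderivWithin_congr (𝕜 := ℝ) (s := spacetime X U) (x := p)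
    (f₁ := fun q => christoffel (rosenMetric h) (spacetime X U) q ξ (1, 0, 0))
    (f := fun q => ((0 : ℝ), (0 : ℝ), (1 / 2 : ℝ) • ((h q.1).inverse * h' q.1) ξ.2.2))
    (fun q hq => by simp [hΓ q hq]) (by simp [hΓ p hp])).trans
      (h1.comp_fst_spacetime.fderivWithin hu)
  rw [riemann, h0, h2, hΓ p hp (1, 0, 0) (1, 0, 0), hΓ p hp ξ (1, 0, 0)]
  rw [hΓ p hp, hΓ p hp]
  simp [formU]
  module

/-- With k = h⁻¹, H'' = -k h' k and H''' = 2 k h' k h' k - k h'' k. Since H''(H')⁻¹H'' = k h' k h'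
k, the coefficient 3/2 leaves 2 - 3/2 = 1/2. -/
theorem schwarzOperator_eq [FiniteDimensional ℝ X] {h h' H : ℝ → X →L[ℝ] X} {h'' : X →L[ℝ] X}
    {U : Set ℝ} (hU : UniqueDiffOn ℝ U) (hi : ∀ u ∈ U, (h u).IsInvertible)
    (hH : ∀ u ∈ U, HasDerivWithinAt H (h u).inverse U u)
    (hd : ∀ u ∈ U, HasDerivWithinAt h (h' u) U u) {u : ℝ} (hu : u ∈ U)
    (hdd : HasDerivWithinAt h' h'' U u) :
    schwarzOperator U H u = -((h u).inverse
      * (h'' - (1 / 2 : ℝ) • (h' u * (h u).inverse * h' u)) * (h u).inverse) := by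
  have d1 : ∀ t ∈ U, derivWithin H U t = (h t).inverse := fun t ht =>
    (hH t ht).derivWithin (hU t ht)
  have hk : ∀ t ∈ U, HasDerivWithinAt (fun t => (h t).inverse)
      (-((h t).inverse * h' t * (h t).inverse)) U t := fun t ht => (hd t ht).clm_inverse (hi t ht)
  have d2 : ∀ t ∈ U, iteratedDerivWithin 2 H U t = -((h t).inverse * h' t * (h t).inverse) := by
    intro t ht
    rw [iteratedDerivWithin_succ, iteratedDerivWithin_one,
      derivWithin_congr d1 (d1 t ht)]
    exact (hk t ht).derivWithin (hU t ht)
  have d3 := (((hk u hu).mul hdd).mul (hk u hu)).neg.derivWithin (hU u hu)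
  have hinv : (h u).inverse * (h u * (h u).inverse) = (h u).inverse := by
    rw [ContinuousLinearMap.mul_def (h u), (hi u hu).self_comp_inverse]
    exact mul_one _
  rw [schwarzOperator, iteratedDerivWithin_succ, derivWithin_congr d2 (d2 u hu), d1 u hu, d2 u hu,
    (hi u hu).inverse_inverse, ← ContinuousLinearMap.mul_def, ← ContinuousLinearMap.mul_def]
  refine (congrArg (· - _) d3).trans ?_
  have h3 : (h u).inverse * h' u * (h u).inverse * (h u * ((h u).inverse * h' u * (h u).inverse))
      = (h u).inverse * h' u * (h u).inverse * h' u * (h u).inverse := by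
    calc _ = (h u).inverse * h' u * ((h u).inverse * (h u * (h u).inverse)) * h' u
          * (h u).inverse := by noncomm_ring
      _ = _ := by rw [hinv]
  simp only [neg_mul, mul_neg, neg_neg, h3, Pi.mul_apply]
  simp only [add_mul, mul_sub, sub_mul, mul_smul_comm, smul_mul_assoc, mul_assoc, neg_mul]
  module

theorem inner_euclTranspose_right [FiniteDimensional ℝ X] (A : X →L[ℝ] X) (x y : X) :
    ⟪x, euclTranspose A y⟫_ℝ = ⟪A x, y⟫_ℝ :=
  LinearMap.adjoint_inner_right (A : X →ₗ[ℝ] X) x y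

theorem hasDerivWithinAt_centralCurve (U : Set ℝ) (u : ℝ) :
    HasDerivWithinAt (centralCurve X) (1, 0, 0) U u :=
  (hasDerivWithinAt_id u U).prodMk
    ((hasDerivWithinAt_const u U (0 : ℝ)).prodMk (hasDerivWithinAt_const u U (0 : X)))

theorem centralTangent_eq {U : Set ℝ} {u : ℝ} (hu : UniqueDiffWithinAt ℝ U u) :
    centralTangent X U u = (1, 0, 0) :=
  (hasDerivWithinAt_centralCurve U u).derivWithin hu

theorem IsRosenProfile.isNullGeodesic_centralCurve [FiniteDimensional ℝ X] {h h' : ℝ → X →L[ℝ] X}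
    {U : Set ℝ} (hh : IsRosenProfile U h) (hU : UniqueDiffOn ℝ U)
    (hd : ∀ u ∈ U, HasDerivWithinAt h (h' u) U u)
    (hs : ∀ u ∈ U, ∀ x y : X, ⟪h' u x, y⟫_ℝ = ⟪x, h' u y⟫_ℝ) :
    IsNullGeodesic (rosenMetric h) (spacetime X U) U (centralCurve X) := by
  have hT : ∀ u ∈ U, derivWithin (centralCurve X) U u = (1, 0, 0) := fun u hu =>
    centralTangent_eq (hU u hu)
  refine ⟨fun u hu => hu, ?_, fun u hu => ?_, fun u hu => ?_, fun u hu => ?_⟩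
  · exact (contDiff_id.prodMk (contDiff_const.prodMk contDiff_const)).contDiffOn
  · simp [hT u hu]
  · simp [hT u hu, rosenMetric_apply]
  · rw [iteratedDerivWithin_succ, iteratedDerivWithin_one, derivWithin_congr hT (hT u hu), hT u hu,
      hh.christoffel_eq (p := centralCurve X u) hU hu (hd u hu) (hs u hu)]
    simp

/-- The derivative of a field of symmetric endomorphisms is symmetric. -/
theorem HasDerivWithinAt.inner_symmetric {f : ℝ → X →L[ℝ] X} {f' : X →L[ℝ] X} {U : Set ℝ} {u : ℝ}
    (hf : HasDerivWithinAt f f' U u) (hU : UniqueDiffWithinAt ℝ U u) (hu : u ∈ U)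
    (hs : ∀ t ∈ U, ∀ x y : X, ⟪f t x, y⟫_ℝ = ⟪x, f t y⟫_ℝ) (x y : X) :
    ⟪f' x, y⟫_ℝ = ⟪x, f' y⟫_ℝ := by
  have h1 := (hf.clm_apply (hasDerivWithinAt_const u U x)).inner ℝ (hasDerivWithinAt_const u U y)
  have h2 := (hasDerivWithinAt_const u U x).inner ℝ (hf.clm_apply (hasDerivWithinAt_const u U y))
  have h3 := hU.eq_deriv _ h1 (h2.congr (fun t ht => hs t ht x y) (hs u hu x y))
  simpa using h3

/-- The bilinear form on the screen space induced by a bilinear form in the differential `dx`. -/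
noncomputable def screenForm (b : (ℝ × ℝ × X) →L[ℝ] (ℝ × ℝ × X) →L[ℝ] ℝ) {T : ℝ × ℝ × X}
    (hT : formX X T = 0) (B : LinearMap.BilinForm ℝ X) : LinearMap.BilinForm ℝ (ScreenSpace b T) :=
  let q : ScreenSpace b T →ₗ[ℝ] X :=
    Submodule.liftQ _ ((formX X : (ℝ × ℝ × X) →ₗ[ℝ] X).comp (orthVectors b T).subtype) (by
      rintro ⟨ξ, hξ⟩ hm
      obtain ⟨c, hc⟩ := Submodule.mem_span_singleton.1 (Submodule.mem_comap.1 hm)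
      change formX X ((orthVectors b T).subtype ⟨ξ, hξ⟩) = 0
      rw [← hc, map_smul, hT, smul_zero])
  B.compl₁₂ q q

theorem screenForm_apply (b : (ℝ × ℝ × X) →L[ℝ] (ℝ × ℝ × X) →L[ℝ] ℝ) {T : ℝ × ℝ × X}
    (hT : formX X T = 0) (B : LinearMap.BilinForm ℝ X) (ξ η : orthVectors b T) :
    screenForm b hT B (screenClass b T ξ) (screenClass b T η) = B (formX X ξ) (formX X η) :=
  rfl

theorem IsNormalTidalCurvature.unique {E : Type*} [NormedAddCommGroup E] [NormedSpace ℝ E]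
    {g : E → E →L[ℝ] E →L[ℝ] ℝ} {M : Set E} {p T : E}
    {P Q : LinearMap.BilinForm ℝ (ScreenSpace (g p) T)}
    (hP : IsNormalTidalCurvature g M p T P) (hQ : IsNormalTidalCurvature g M p T Q) : P = Q := by
  refine LinearMap.ext₂ fun a b => ?_
  obtain ⟨ξ, rfl⟩ := Submodule.Quotient.mk_surjective _ a
  obtain ⟨η, rfl⟩ := Submodule.Quotient.mk_surjective _ b
  exact (hP ξ η).trans (hQ ξ η).symm

end RosenCurvature

theorem mainTheorem12 {X : Type*} [NormedAddCommGroup X] [InnerProductSpace ℝ X]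
    [FiniteDimensional ℝ X] (U : Set ℝ) (hU : U.OrdConnected) (hU' : U.Nontrivial)
    (h : ℝ → X →L[ℝ] X) (hh : IsRosenProfile U h)
    (H : ℝ → X →L[ℝ] X) (hH : ∀ u ∈ U, HasDerivWithinAt H (h u).inverse U u) :
    IsNullGeodesic (rosenMetric h) (spacetime X U) U (centralCurve X) ∧
    ∀ u ∈ U, ∃ P : LinearMap.BilinForm ℝ
        (ScreenSpace (rosenMetric h (centralCurve X u)) (centralTangent X U u)),
      IsNormalTidalCurvature (rosenMetric h) (spacetime X U)
        (centralCurve X u) (centralTangent X U u) P ∧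
      (∀ Q, IsNormalTidalCurvature (rosenMetric h) (spacetime X U)
        (centralCurve X u) (centralTangent X U u) Q → Q = P) ∧
      (∀ ξ η : orthVectors (rosenMetric h (centralCurve X u)) (centralTangent X U u),
        P (screenClass _ _ ξ) (screenClass _ _ η) =
          -(1 / 2) * ⟪formX X ξ, (derivWithin H U u).inverse
            (schwarzOperator U H u ((derivWithin H U u).inverse (formX X η)))⟫_ℝ) ∧
      (∀ L : ℝ → X →L[ℝ] X, IsLagrangianMatrix U L →
        (∀ t ∈ U, (euclTranspose (L t)).comp (L t) = h t) →
        ∀ ξ η : orthVectors (rosenMetric h (centralCurve X u)) (centralTangent X U u),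
          P (screenClass _ _ ξ) (screenClass _ _ η) =
            -(1 / 2) * ⟪L u (formX X ξ), lagrangeSchwarzian U H L u (L u (formX X η))⟫_ℝ) := by
  -- Nondegeneracy of the interval makes one-sided derivatives at its endpoints unique.
  have hUD : UniqueDiffOn ℝ U := uniqueDiffOn_convex hU.convex
    (hU.convex.nontrivial_iff_nonempty_interior.1 hU')
  have hd : ∀ u ∈ U, HasDerivWithinAt h (derivWithin h U u) U u := fun u hu =>
    (hh.smooth.differentiableOn (by simp) u hu).hasDerivWithinAt
  have hdd : ∀ u ∈ U, HasDerivWithinAt (derivWithin h U) (derivWithin (derivWithin h U) U u) U u :=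
    fun u hu => ((hh.smooth.derivWithin (m := ∞) hUD (by simp)).differentiableOn
      (by simp) u hu).hasDerivWithinAt
  have hs : ∀ u ∈ U, ∀ x y : X,
      ⟪derivWithin h U u x, y⟫_ℝ = ⟪x, derivWithin h U u y⟫_ℝ := fun u hu =>
    (hd u hu).inner_symmetric (hUD u hu) hu hh.symmetric
  have hss : ∀ u ∈ U, ∀ x y : X, ⟪derivWithin (derivWithin h U) U u x, y⟫_ℝ
      = ⟪x, derivWithin (derivWithin h U) U u y⟫_ℝ := fun u hu =>
    (hdd u hu).inner_symmetric (hUD u hu) hu hs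
  refine ⟨hh.isNullGeodesic_centralCurve hUD hd hs, fun u hu => ?_⟩
  have hi := hh.isInvertible hu
  have hT := centralTangent_eq (X := X) (hUD u hu)
  have hTX : formX X (centralTangent X U u) = 0 := by rw [hT]; rfl
  have hH' : (derivWithin H U u).inverse = h u := by
    rw [(hH u hu).derivWithin (hUD u hu), hi.inverse_inverse]
  have hks : ∀ x y : X, ⟪(h u).inverse x, y⟫_ℝ = ⟪x, (h u).inverse y⟫_ℝ := fun x y => by
    conv_lhs => rw [← hi.self_apply_inverse y]
    rw [← hh.symmetric u hu, hi.self_apply_inverse]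
  have hS : ∀ x : X, h u (schwarzOperator U H u (h u x))
      = -(derivWithin (derivWithin h U) U u x - (1 / 2 : ℝ) •
        derivWithin h U u ((h u).inverse (derivWithin h U u x))) := fun x => by
    rw [schwarzOperator_eq hUD (fun t ht => hh.isInvertible ht) hH hd hu (hdd u hu)]
    simp [hi.self_apply_inverse, hi.inverse_apply_self]
  let B : LinearMap.BilinForm ℝ X := (innerₗ X).compl₁₂ LinearMap.id
    (-(1 / 2 : ℝ) • (((h u).comp ((schwarzOperator U H u).comp (h u)) : X →L[ℝ] X) : X →ₗ[ℝ] X))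
  have hB : ∀ x y : X, B x y = -(1 / 2) * ⟪x, h u (schwarzOperator U H u (h u y))⟫_ℝ :=
    fun x y => by simp [B, inner_smul_right]
  have hP : IsNormalTidalCurvature (rosenMetric h) (spacetime X U) (centralCurve X u)
      (centralTangent X U u) (screenForm _ hTX B) := by
    intro ξ η
    have hR := hh.riemann_eq (p := centralCurve X u) hUD hd hs hu (hdd u hu)
    rw [← hT] at hR
    change ∀ ζ, _ = ((0 : ℝ), (0 : ℝ), (h u).inverse (_ • (_ - _ • derivWithin h U u
      ((h u).inverse (derivWithin h U u _))))) at hR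
    rw [screenForm_apply, hB, hS, hR, rosenMetric_apply]
    change _ = (0 : ℝ) * _ + 0 * _ - ⟪(h u).inverse _, h u _⟫_ℝ
    rw [hks, hi.inverse_apply_self]
    -- Lowering the index has cancelled h⁻¹ against h; symmetry of h', h'' and h⁻¹ now moves the
    -- operator from ξ to η.
    simp only [formX, inner_smul_left, inner_sub_left, inner_neg_right, inner_sub_right,
      inner_smul_right, hs u hu, hss u hu, hks]
    simp
    ring
  refine ⟨screenForm _ hTX B, hP, fun Q hQ => hQ.unique hP, fun ξ η => ?_, fun L _ hL ξ η => ?_⟩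
  · rw [screenForm_apply, hB, hH']
  · rw [screenForm_apply, hB, lagrangeSchwarzian, ← inner_euclTranspose_right]
    have hL' : ∀ x, euclTranspose (L u) (L u x) = h u x := fun x => by rw [← hL u hu]; rfl
    simp only [ContinuousLinearMap.comp_apply, hL']
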